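/- **Conventions.** Sequences $X\in 2^\omega$ are identified with subsets of $\omega$; $X{\upharpoonright}n$ is the string of the first $n$ bits of $X$; $[\![\sigma]\!]$ is the set of sequences extending the finite string $\sigma$; $\lambda$ is Lebesgue (fair-coin) measure on $2^\omega$. A probability measure $\mu$ on $2^\omega$ is computable if there is a computable function $\hat\mu$ from $2^{<\omega}\times\omega$ to the dyadic rationals with $|\mu([\![\sigma]\!])-\hat\mu(\sigma,i)|\le 2^{-i}$ for all $\sigma,i$. We write $\mathsf{Atoms}_\mu=\{X:\mu(\{X\})>0\}$, and a computable probability measure $\mu$ is called trivial if $\mu(\mathsf{Atoms}_\mu)=1$. $\mathsf{MLR}_\mu$ is the set of $\mu$-Martin-Löf random sequences, i.e. those $X$ such that $X\notin\bigcap_i\mathcal U_i$ for every uniformly effectively open sequence $(\mathcal U_i)_{i\in\omega}$ with $\mu(\mathcal U_i)\le 2^{-i}$ for all $i$; $\mathsf{MLR}=\mathsf{MLR}_\lambda$. **Theorem.** Let $A\in 2^\omega$ be a noncomputable $\Delta^0_2$ sequence, and let $(A_s)_{s\in\omega}$ be a $\Delta^0_2$ approximation of $A$, that is, a uniformly computable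 sequence of finite sets such that $\lim_s A_s(n)=A(n)$ for every $n$. For $X\in2^\omega$ and $n\in\omega$ let $\theta(X,n)$ be the least $s$ such that $X{\upharpoonright}n=A_s{\upharpoonright}n$, and $\theta(X,n)=+\infty$ if there is no such $s$. Let $\Phi_A:2^\omega\to2^\omega$ be the tally functional $$\Phi_A(X)=1^{\theta(X,0)}\,0\,1^{\theta(X,1)}\,0\,1^{\theta(X,2)}\,0\cdots,$$ where the output ends in $1^\omega$ from the first infinite block on (so $\Phi_A(X)=1^{\theta(X,0)}\,0\cdots1^{\theta(X,k-1)}\,0\,1^\omega$ if $k$ is least with $\theta(X,k)=+\infty$). Let $\mu$ be the measure induced by $\Phi_A$, i.e. $\mu(\mathcal X)=\lambda(\Phi_A^{-1}(\mathcal X))$ for Borel $\mathcal X\subseteq 2^\omega$. Then: 1. $\mu$ is a trivial computable probability measure. 2. If $A\in\mathsf{MLR}$, then $\mathsf{MLR}_\mu\setminus\mathsf{Atoms}_\mu=\{\Phi_A(A)\}$. -/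

import Mathlib

open MeasureTheory Filter
open scoped ENNReal

namespace Cantor

/-- The restriction of a sequence `X ∈ 2^ω` to its first `n` bits, a finite string. -/
def restr (X : ℕ → Bool) (n : ℕ) : List Bool := (List.range n).map X

/-- The basic open set `⟦σ⟧` of all sequences that extend the string `σ`. -/
def cyl (σ : List Bool) : Set (ℕ → Bool) := {X | restr X σ.length = σ}

/-- Lebesgue measure on `2^ω`: the product of the uniform measures on `{0,1}`. -/
noncomputable def lebesgue : Measure (ℕ → Bool) :=
  Measure.infinitePi fun _ : ℕ => (PMF.uniformOfFintype Bool).toMeasure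

/-- `μ` is a computable probability measure: the values `μ(⟦σ⟧)` are uniformly approximated,
to within `2^{-i}`, by a computable sequence of dyadic rationals. The pair `(a, k)` stands for
the dyadic rational `a / 2^k`. -/
def IsComputableProb (μ : Measure (ℕ → Bool)) : Prop :=
  IsProbabilityMeasure μ ∧
    ∃ f : List Bool → ℕ → ℤ × ℕ, Computable₂ f ∧
      ∀ (σ : List Bool) (i : ℕ),
        |μ.real (cyl σ) - ((f σ i).1 : ℝ) / 2 ^ (f σ i).2| ≤ ((2 : ℝ) ^ i)⁻¹

/-- The set of atoms of `μ`. -/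
def atoms (μ : Measure (ℕ → Bool)) : Set (ℕ → Bool) := {X | 0 < μ {X}}

/-- A computable probability measure is trivial if its atoms carry all of its mass. -/
def IsTrivial (μ : Measure (ℕ → Bool)) : Prop :=
  IsComputableProb μ ∧ μ (atoms μ) = 1

/-- `U` is a uniformly computable sequence of effectively open classes: for some computably
enumerable `W ⊆ ω × 2^{<ω}`, each `U i` is the union of the `⟦σ⟧` with `(i, σ) ∈ W`. -/
def IsUniformlyEffectivelyOpen (U : ℕ → Set (ℕ → Bool)) : Prop :=
  ∃ W : ℕ × List Bool → Prop, REPred W ∧ ∀ i, U i = {X | ∃ σ, W (i, σ) ∧ X ∈ cyl σ}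

/-- Martin-Löf tests with respect to `μ`. -/
def IsMLTest (μ : Measure (ℕ → Bool)) (U : ℕ → Set (ℕ → Bool)) : Prop :=
  IsUniformlyEffectivelyOpen U ∧ ∀ i, μ (U i) ≤ ((2 : ℝ≥0∞) ^ i)⁻¹

/-- The set of Martin-Löf random sequences with respect to `μ`. -/
def MLR (μ : Measure (ℕ → Bool)) : Set (ℕ → Bool) :=
  {X | ∀ U : ℕ → Set (ℕ → Bool), IsMLTest μ U → X ∉ ⋂ i, U i}

/-- `(A_s)` is a `Δ⁰₂` approximation of `A`: a uniformly computable sequence of finite sets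
that converges to `A` pointwise. -/
structure IsDelta2Approx (As : ℕ → ℕ → Bool) (A : ℕ → Bool) : Prop where
  computable : Computable₂ As
  finite : ∀ s, {n | As s n = true}.Finite
  tendsto : ∀ n, ∀ᶠ s in atTop, As s n = A n

/-- `θ(X, n)`: the least `s` such that `Θ(X, n, s)`, and `+∞` if there is none. -/
noncomputable def theta (Θ : (ℕ → Bool) → ℕ → ℕ → Prop) (X : ℕ → Bool) (n : ℕ) : ℕ∞ :=
  ⨅ (s : ℕ) (_ : Θ X n s), (s : ℕ∞)

open Classical in
/-- The tally functional `Φ_Θ(X) = 1^{θ(X,0)} 0 1^{θ(X,1)} 0 1^{θ(X,2)} 0 …`, which ends in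
`1^ω` from the first infinite block on. The zero that closes block `k` stands at position
`θ(X,0) + … + θ(X,k) + k` (if this is finite); all other bits are one. -/
noncomputable def tally (Θ : (ℕ → Bool) → ℕ → ℕ → Prop) (X : ℕ → Bool) : ℕ → Bool :=
  fun m => if ∃ k : ℕ, (∑ i ∈ Finset.range (k + 1), theta Θ X i) + k = (m : ℕ∞)
    then false else true

/-- The tally functional `Φ_A` of an approximation `(A_s)`: here `Θ(X, n, s)` says that
`X` and `A_s` have the same first `n` bits. -/
noncomputable def tallyApprox (As : ℕ → ℕ → Bool) : (ℕ → Bool) → ℕ → Bool :=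
  tally fun X n s => restr X n = restr (As s) n

/-- The measure `λ_Φ` induced by `Φ`: `λ_Φ(S) = λ(Φ⁻¹(S))`. -/
noncomputable def inducedMeasure (Φ : (ℕ → Bool) → ℕ → Bool) : Measure (ℕ → Bool) :=
  lebesgue.map Φ

end Cantor

/-!
The first `N` bits of `Φ_A(X)` depend computably on the first `N` bits of `X`, although some of
the blocks may be infinite: a block that is not decided by the first `N` bits of the first `N`
stages contributes only ones below position `N` (`restr_tallyApprox`). So `Φ_A` is a total
continuous map computed by a length-preserving function `g` on strings (`computes_tallyApprox`),
and four facts hold for every such map. The induced measure of `⟦σ⟧` is the proportion of strings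
of length `|σ|` that `g` sends to `σ`, hence computable (`Computes.isComputableProb`). Tests for
the induced measure pull back to tests for Lebesgue measure (`Computes.apply_mem_MLR`). A random
sequence lies in the range, since the range is compact and the complement is covered by cylinders
of measure zero (`Computes.mem_range_of_mem_MLR`). A computable random sequence is an atom, since
otherwise its prefixes of small measure form a test (`Computes.mem_atoms_of_computable`).

The other half is about the inputs for which all `θ(X, n)` are finite. These are `A` and the
stages `A_s` (`eq_or_eq_stage_of_theta_ne_top`). All other outputs end in ones, so almost every
output lies in a countable set, which makes the measure trivial. Every output on an input other than
`A` is computable, so it is an atom or not random. What remains is `Φ_A(A)`: it is random if `A` is,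
and it is not an atom, because it has infinitely many zeros and so its preimage is countable.
-/

namespace Cantor

/-! ### Finite strings and cylinders -/

@[simp]
theorem length_restr (X : ℕ → Bool) (n : ℕ) : (restr X n).length = n := by
  simp [restr]

theorem restr_eq_restr_iff {X Y : ℕ → Bool} {n : ℕ} :
    restr X n = restr Y n ↔ ∀ i < n, X i = Y i := by
  simp [restr, List.map_inj_left]

theorem getElem?_restr {X : ℕ → Bool} {n m : ℕ} (h : m < n) : (restr X n)[m]? = some (X m) := by
  simp [restr, h]

theorem take_restr (X : ℕ → Bool) {m n : ℕ} (h : m ≤ n) :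
    (restr X n).take m = restr X m := by
  rw [restr, ← List.map_take, List.take_range, min_eq_left h, restr]

theorem mem_cyl_restr {X Y : ℕ → Bool} {n : ℕ} :
    X ∈ cyl (restr Y n) ↔ restr X n = restr Y n := by
  simp [cyl]

theorem mem_cyl_restr_self (X : ℕ → Bool) (n : ℕ) : X ∈ cyl (restr X n) :=
  mem_cyl_restr.2 rfl

theorem cyl_restr_anti (Y : ℕ → Bool) : Antitone fun n => cyl (restr Y n) := by
  intro m n h X hX
  rw [mem_cyl_restr, restr_eq_restr_iff] at *
  exact fun i hi => hX i (hi.trans_le h)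

theorem iInter_cyl_restr (Y : ℕ → Bool) : ⋂ n, cyl (restr Y n) = {Y} := by
  ext X
  simp only [Set.mem_iInter, mem_cyl_restr, restr_eq_restr_iff, Set.mem_singleton_iff]
  exact ⟨fun h => funext fun i => h (i + 1) i i.lt_succ_self, fun h _ _ _ => h ▸ rfl⟩

theorem cyl_eq_pi (σ : List Bool) :
    cyl σ = Set.pi (Finset.range σ.length) fun i => {σ.getD i false} := by
  ext X
  simp only [cyl, Set.mem_ofPred_eq, Set.mem_pi, Finset.coe_range, Set.mem_Iio,
    Set.mem_singleton_iff]
  constructor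
  · intro h i hi
    rw [← h]
    simp [List.getD, getElem?_restr hi]
  · intro h
    refine List.ext_getElem (by simp) fun i h₁ h₂ => ?_
    simp [restr, h i h₂, h₂]

theorem isOpen_cyl (σ : List Bool) : IsOpen (cyl σ) := by
  rw [cyl_eq_pi]
  exact isOpen_set_pi (Finset.finite_toSet _) fun _ _ => isOpen_discrete _

theorem measurableSet_cyl (σ : List Bool) : MeasurableSet (cyl σ) := (isOpen_cyl σ).measurableSet

/-- The cylinders given by the prefixes of `Y` form a neighbourhood base at `Y`. -/
theorem exists_cyl_subset {U : Set (ℕ → Bool)} (hU : IsOpen U) {Y : ℕ → Bool} (hY : Y ∈ U) :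
    ∃ n, cyl (restr Y n) ⊆ U := by
  obtain ⟨I, u, hu, hsub⟩ := isOpen_pi_iff.1 hU Y hY
  refine ⟨I.sup id + 1, fun X hX => hsub fun i hi => ?_⟩
  rw [mem_cyl_restr, restr_eq_restr_iff] at hX
  rw [hX i (Nat.lt_succ_of_le (Finset.le_sup (f := id) hi))]
  exact (hu i hi).2

/-! ### Lebesgue measure of cylinders -/

instance : IsProbabilityMeasure lebesgue := by
  unfold lebesgue
  infer_instance

theorem lebesgue_cyl (σ : List Bool) : lebesgue (cyl σ) = ((2 : ℝ≥0∞) ^ σ.length)⁻¹ := by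
  rw [cyl_eq_pi, lebesgue, Measure.infinitePi_pi _ (fun _ _ => measurableSet_singleton _)]
  simp [ENNReal.inv_pow]

theorem lebesgue_singleton (X : ℕ → Bool) : lebesgue {X} = 0 := by
  have h : Tendsto (fun n : ℕ => (2⁻¹ : ℝ≥0∞) ^ n) atTop (nhds 0) :=
    ENNReal.tendsto_pow_atTop_nhds_zero_of_lt_one (by simp)
  refine le_antisymm (ge_of_tendsto' h fun n => ?_) zero_le
  calc lebesgue {X} ≤ lebesgue (cyl (restr X n)) :=
        measure_mono (Set.singleton_subset_iff.2 (mem_cyl_restr_self X n))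
    _ = 2⁻¹ ^ n := by rw [lebesgue_cyl, length_restr, ENNReal.inv_pow]

instance : NullSingletonClass lebesgue := ⟨lebesgue_singleton⟩

/-- The strings of length `n`, as a list without repetitions. -/
def strings : ℕ → List (List Bool)
  | 0 => [[]]
  | n + 1 => (strings n).map (List.cons false) ++ (strings n).map (List.cons true)

theorem mem_strings {n : ℕ} {τ : List Bool} : τ ∈ strings n ↔ τ.length = n := by
  induction n generalizing τ with
  | zero => simp [strings]
  | succ n ih =>
    cases τ with
    | nil => simp [strings]
    | cons b τ => cases b <;> simp [strings, ih]

theorem nodup_strings (n : ℕ) : (strings n).Nodup := by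
  induction n with
  | zero => simp [strings]
  | succ n ih =>
    refine List.Nodup.append (ih.map List.cons_injective) (ih.map List.cons_injective) ?_
    intro τ h₀ h₁
    obtain ⟨_, -, rfl⟩ := List.mem_map.1 h₀
    simp at h₁

/-- The measure of a class that is determined by the first `n` bits is a count of strings. -/
theorem lebesgue_real_setOf_restr_mem {n : ℕ} {l : List (List Bool)} (hl : l.Nodup)
    (hn : ∀ τ ∈ l, τ.length = n) : lebesgue.real {X | restr X n ∈ l} = l.length / 2 ^ n := by
  induction l with
  | nil => simp
  | cons τ l ih =>
    rw [List.nodup_cons] at hl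
    have hτ : τ.length = n := hn τ (by simp)
    have hsplit : {X | restr X n ∈ τ :: l} = cyl τ ∪ {X | restr X n ∈ l} := by
      ext X
      simp [cyl, hτ]
    have hdisj : Disjoint (cyl τ) {X | restr X n ∈ l} := by
      rw [Set.disjoint_left]
      intro X hX hX'
      rw [cyl, Set.mem_ofPred_eq, hτ] at hX
      exact hl.1 (hX ▸ hX')
    rw [hsplit, measureReal_union' hdisj (measurableSet_cyl τ),
      ih hl.2 fun σ hσ => hn σ (by simp [hσ])]
    have : lebesgue.real (cyl τ) = 1 / 2 ^ n := by
      simp [measureReal_def, lebesgue_cyl, hτ]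
    rw [this]
    push_cast [List.length_cons]
    ring

/-! ### Computability of operations on lists and numbers -/

section Computability

variable {α β σ : Type*} [Primcodable α] [Primcodable β] [Primcodable σ]

theorem computable_map_range {f : α → ℕ → σ} (hf : Computable₂ f) :
    Computable₂ fun a n => (List.range n).map (f a) := by
  have h : Computable₂ fun (p : α × ℕ) (q : ℕ × List σ) => q.2 ++ [f p.1 q.1] :=
    Computable.list_concat.comp (Computable.snd.comp Computable.snd)
      (hf.comp (Computable.fst.comp Computable.fst) (Computable.fst.comp Computable.snd))
  refine (Computable.nat_rec Computable.snd (Computable.const []) h).of_eq fun p => ?_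
  obtain ⟨a, n⟩ := p
  induction n with
  | zero => rfl
  | succ n ih => simp_all [List.range_succ]

theorem computable_list_map {f : β → σ} (hf : Computable f) :
    Computable fun l : List β => l.map f := by
  -- Mathlib has this for primitive recursive `f` only; a map over `List.range` reduces it to
  -- recursion on numbers.
  have h : Computable₂ fun (l : List β) (i : ℕ) => l[i]?.map f :=
    Computable.option_map Computable.list_getElem? (hf.comp Computable.snd).to₂
  have hfm : Primrec fun l : List (Option σ) => l.filterMap id :=
    Primrec.listFilterMap Primrec.id Primrec.snd
  refine (hfm.to_comp.comp ((computable_map_range h).comp Computable.id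
    Computable.list_length)).of_eq fun l => ?_
  have : (List.range l.length).map (fun i => l[i]?.map f) = (l.map f).map some := by
    refine List.ext_getElem (by simp) fun i h₁ h₂ => ?_
    simp only [List.length_map] at h₂
    simp [h₂]
  change ((List.range l.length).map fun i => l[i]?.map f).filterMap id = l.map f
  rw [this]
  simp [List.filterMap_map]

theorem primrec_list_sum : Primrec fun l : List ℕ => l.sum :=
  (Primrec.list_foldr Primrec.id (Primrec.const 0)
    (Primrec.nat_add.comp (Primrec.fst.comp Primrec.snd)
      (Primrec.snd.comp Primrec.snd)).to₂).of_eq fun _ => rfl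

theorem primrec_list_count [BEq β] [LawfulBEq β] :
    Primrec₂ fun (b : β) (l : List β) => l.count b := by
  classical
  have h : PrimrecRel fun c b : β => c = b := Primrec.eq
  refine (Primrec.list_length.comp (h.listFilter.comp Primrec.snd Primrec.fst)).of_eq
    fun p => ?_
  change _ = p.2.count p.1
  rw [List.count_eq_length_filter]
  congr 2
  funext c
  rw [Bool.eq_iff_iff]
  simp

theorem computable_strings : Computable strings := by
  have hc (b : Bool) : Primrec fun l : List (List Bool) => l.map (List.cons b) :=
    Primrec.list_map Primrec.id (Primrec.list_cons.comp (Primrec.const b) Primrec.snd).to₂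
  have h : Primrec fun l : List (List Bool) =>
      l.map (List.cons false) ++ l.map (List.cons true) :=
    Primrec.list_append.comp (hc false) (hc true)
  refine (Primrec.nat_rec₁ [[]] (h.comp Primrec.snd).to₂).to_comp.of_eq fun n => ?_
  induction n with
  | zero => rfl
  | succ n ih => simp only [strings, ← ih]

theorem computable_two_pow : Computable fun n : ℕ => 2 ^ n := by
  have h : Primrec₂ fun _ m : ℕ => 2 * m :=
    (Primrec.nat_mul.comp (Primrec.const 2) Primrec.snd).to₂
  refine (Primrec.nat_rec₁ 1 h).to_comp.of_eq fun n => ?_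
  induction n with
  | zero => rfl
  | succ n ih => simp only [ih, pow_succ']

theorem computable_int_ofNat : Computable Int.ofNat :=
  -- The encoding of `ℤ` sends a natural number `n` to `2 * n`.
  (Primrec.encode_iff.1 ((Primrec.nat_mul.comp (Primrec.const 2) Primrec.id).of_eq
    fun _ => rfl)).to_comp

theorem _root_.REPred.comp {p : β → Prop} (hp : REPred p) {f : α → β} (hf : Computable f) :
    REPred fun a => p (f a) :=
  Partrec.comp hp hf

end Computability

/-! ### Functionals computed bit by bit -/

/-- The string function `g` computes `Φ` bit by bit: the first `n` bits of `Φ X` are obtained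
by `g` from the first `n` bits of `X`. -/
structure Computes (g : List Bool → List Bool) (Φ : (ℕ → Bool) → ℕ → Bool) : Prop where
  computable : Computable g
  restr_apply : ∀ X n, restr (Φ X) n = g (restr X n)

theorem computable_of_restr {Y : ℕ → Bool} (h : Computable (restr Y)) : Computable Y := by
  refine ((Primrec.list_getD true).to_comp.comp (h.comp Computable.succ) Computable.id).of_eq
    fun n => ?_
  change (restr Y (n + 1))[n]?.getD true = Y n
  rw [getElem?_restr n.lt_succ_self, Option.getD_some]

theorem computable_restr {Y : ℕ → Bool} (h : Computable Y) : Computable (restr Y) :=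
  (computable_map_range (α := Unit) (h.comp Computable.snd).to₂).comp
    (Computable.const ()) Computable.id

namespace Computes

variable {g : List Bool → List Bool} {Φ : (ℕ → Bool) → ℕ → Bool} (h : Computes g Φ)
include h

theorem computable_apply {X : ℕ → Bool} (hX : Computable X) : Computable (Φ X) :=
  computable_of_restr <| (h.computable.comp (computable_restr hX)).of_eq fun n =>
    (h.restr_apply X n).symm

theorem continuous : Continuous Φ := by
  refine continuous_pi fun m => ((IsLocallyConstant.iff_exists_open _).2 fun X =>
    ⟨cyl (restr X (m + 1)), isOpen_cyl _, mem_cyl_restr_self X _, fun X' hX' => ?_⟩).continuous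
  have : restr (Φ X') (m + 1) = restr (Φ X) (m + 1) := by
    rw [h.restr_apply, h.restr_apply, mem_cyl_restr.1 hX']
  exact restr_eq_restr_iff.1 this m m.lt_succ_self

theorem inducedMeasure_apply {S : Set (ℕ → Bool)} (hS : MeasurableSet S) :
    inducedMeasure Φ S = lebesgue (Φ ⁻¹' S) :=
  Measure.map_apply h.continuous.measurable hS

theorem isProbabilityMeasure : IsProbabilityMeasure (inducedMeasure Φ) :=
  Measure.isProbabilityMeasure_map h.continuous.measurable.aemeasurable

/-- The induced measure of `⟦σ⟧` is exactly the proportion of strings of length `|σ|` that `g`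
sends to `σ`. -/
theorem inducedMeasure_real_cyl (σ : List Bool) : (inducedMeasure Φ).real (cyl σ) =
    (((strings σ.length).map g).count σ : ℝ) / 2 ^ σ.length := by
  have hpre : Φ ⁻¹' cyl σ =
      {X | restr X σ.length ∈ (strings σ.length).filter fun τ => g τ = σ} := by
    ext X
    simp [cyl, mem_strings, h.restr_apply]
  rw [measureReal_def, h.inducedMeasure_apply (measurableSet_cyl σ), hpre, ← measureReal_def,
    lebesgue_real_setOf_restr_mem ((nodup_strings _).filter _)
      fun τ hτ => mem_strings.1 (List.mem_filter.1 hτ).1]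
  congr 2
  rw [List.count_eq_length_filter, List.filter_map, List.length_map]
  congr 2
  funext τ
  rw [Bool.eq_iff_iff]
  simp

theorem computable_count :
    Computable fun σ : List Bool => ((strings σ.length).map g).count σ :=
  primrec_list_count.to_comp.comp Computable.id
    ((computable_list_map h.computable).comp (computable_strings.comp Computable.list_length))

theorem isComputableProb : IsComputableProb (inducedMeasure Φ) := by
  refine ⟨h.isProbabilityMeasure,
    fun σ _ => (((strings σ.length).map g).count σ, σ.length), ?_, fun σ i => ?_⟩
  · exact ((computable_int_ofNat.comp h.computable_count).pair Computable.list_length).comp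
      Computable.fst
  · rw [h.inducedMeasure_real_cyl]
    simp

/-- Preservation of randomness: a test for the induced measure pulls back along `Φ` to a test
for Lebesgue measure. -/
theorem apply_mem_MLR {X : ℕ → Bool} (hX : X ∈ MLR lebesgue) :
    Φ X ∈ MLR (inducedMeasure Φ) := by
  rintro U ⟨⟨W, hW, hU⟩, hμ⟩ hmem
  have hUopen (i : ℕ) : IsOpen (U i) := by
    have : U i = ⋃ σ, ⋃ (_ : W (i, σ)), cyl σ := by
      ext Y
      simp [hU]
    rw [this]
    exact isOpen_iUnion fun σ => isOpen_iUnion fun _ => isOpen_cyl σ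
  refine hX (fun i => Φ ⁻¹' U i) ⟨⟨fun p => W (p.1, g p.2), ?_, fun i => ?_⟩, fun i => ?_⟩
    (by simpa using hmem)
  · exact hW.comp (Computable.fst.pair (h.computable.comp Computable.snd))
  · ext Z
    simp only [hU, Set.preimage_ofPred_eq, Set.mem_ofPred_eq]
    constructor
    · rintro ⟨σ, hσ, hZ⟩
      refine ⟨restr Z σ.length, ?_, mem_cyl_restr_self Z _⟩
      rwa [← h.restr_apply, show restr (Φ Z) σ.length = σ from hZ]
    · rintro ⟨τ, hτ, hZ⟩
      refine ⟨restr (Φ Z) τ.length, ?_, mem_cyl_restr_self _ _⟩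
      rwa [h.restr_apply, show restr Z τ.length = τ from hZ]
  · rw [← h.inducedMeasure_apply (hUopen i).measurableSet]
    exact hμ i

/-- The range of `Φ` is compact, so a sequence outside of it lies in a cylinder of measure
zero. -/
theorem mem_range_of_mem_MLR {Y : ℕ → Bool} (hY : Y ∈ MLR (inducedMeasure Φ)) :
    Y ∈ Set.range Φ := by
  by_contra hrange
  obtain ⟨n, hn⟩ := exists_cyl_subset (isCompact_range h.continuous).isClosed.isOpen_compl hrange
  have hnull : inducedMeasure Φ (cyl (restr Y n)) = 0 := by
    rw [h.inducedMeasure_apply (measurableSet_cyl _)]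
    convert measure_empty (μ := lebesgue)
    refine Set.eq_empty_of_forall_notMem fun X hX => hn hX ⟨X, rfl⟩
  refine hY (fun _ => cyl (restr Y n)) ⟨⟨fun p => p.2 = restr Y n, ?_, fun i => ?_⟩,
    fun i => by simp [hnull]⟩ (Set.mem_iInter.2 fun _ => mem_cyl_restr_self Y n)
  · have : PrimrecPred fun p : ℕ × List Bool => p.2 = restr Y n :=
      Primrec.eq.comp Primrec.snd (Primrec.const _)
    exact ComputablePred.to_re ⟨inferInstance, this.decide.to_comp⟩
  · simp

/-- The prefixes of a computable `Y` whose measure is at most `2^{-i}` form a test, and this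
test covers `Y` unless `Y` is an atom. -/
theorem mem_atoms_of_computable {Y : ℕ → Bool} (hY : Computable Y)
    (hmlr : Y ∈ MLR (inducedMeasure Φ)) : Y ∈ atoms (inducedMeasure Φ) := by
  have := h.isProbabilityMeasure
  by_contra hatom
  set μ := inducedMeasure Φ
  have hsmall (σ : List Bool) (i : ℕ) : μ (cyl σ) ≤ ((2 : ℝ≥0∞) ^ i)⁻¹ ↔
      ((strings σ.length).map g).count σ * 2 ^ i ≤ 2 ^ σ.length := by
    rw [← ENNReal.toReal_le_toReal (measure_ne_top _ _) (by simp), ← measureReal_def,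
      h.inducedMeasure_real_cyl, div_le_iff₀ (by positivity)]
    simp only [ENNReal.toReal_inv, ENNReal.toReal_pow, ENNReal.toReal_ofNat]
    rw [inv_mul_eq_div, le_div_iff₀ (by positivity)]
    exact_mod_cast Iff.rfl
  let W : ℕ × List Bool → Prop := fun p =>
    p.2 = restr Y p.2.length ∧
      ((strings p.2.length).map g).count p.2 * 2 ^ p.1 ≤ 2 ^ p.2.length
  have hW : REPred W := by
    have h₁ : Computable fun p : ℕ × List Bool => decide (p.2 = restr Y p.2.length) :=
      (Primrec.eq (α := List Bool)).decide.to_comp.comp Computable.snd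
        ((computable_restr hY).comp (Computable.list_length.comp Computable.snd))
    have h₂ : Computable fun p : ℕ × List Bool =>
        decide (((strings p.2.length).map g).count p.2 * 2 ^ p.1 ≤ 2 ^ p.2.length) :=
      Primrec.nat_le.decide.to_comp.comp
        (Primrec.nat_mul.to_comp.comp (h.computable_count.comp Computable.snd)
          (computable_two_pow.comp Computable.fst))
        (computable_two_pow.comp (Computable.list_length.comp Computable.snd))
    refine ComputablePred.to_re ⟨inferInstance, (Primrec.and.to_comp.comp h₁ h₂).of_eq fun p => ?_⟩
    simp [W]
  refine hmlr (fun i => {X | ∃ σ, W (i, σ) ∧ X ∈ cyl σ}) ⟨⟨W, hW, fun _ => rfl⟩, fun i => ?_⟩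
    (Set.mem_iInter.2 fun i => ?_)
  · -- The cylinders enumerated at level `i` are nested; the shortest prefix contains the others.
    by_cases hex : ∃ n, μ (cyl (restr Y n)) ≤ ((2 : ℝ≥0∞) ^ i)⁻¹
    · classical
      refine (measure_mono fun X hX => ?_).trans (Nat.find_spec hex)
      obtain ⟨σ, ⟨hσ, hle⟩, hX⟩ := hX
      rw [show σ = restr Y σ.length from hσ] at hX
      rw [← hsmall, hσ] at hle
      exact cyl_restr_anti Y (Nat.find_min' hex hle) hX
    · refine le_of_eq_of_le ?_ zero_le
      convert measure_empty (μ := μ)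
      refine Set.eq_empty_of_forall_notMem ?_
      rintro X ⟨σ, ⟨hσ, hle⟩, -⟩
      rw [← hsmall, hσ] at hle
      exact hex ⟨_, hle⟩
  · -- If `Y` is not an atom, then the measures of its prefixes tend to `μ {Y} = 0`.
    have hlim := tendsto_measure_iInter_atTop (μ := μ)
      (fun n => (measurableSet_cyl (restr Y n)).nullMeasurableSet) (cyl_restr_anti Y)
      ⟨0, measure_ne_top _ _⟩
    rw [iInter_cyl_restr, show μ {Y} = 0 by simpa [atoms] using hatom] at hlim
    obtain ⟨n, hn⟩ := ((tendsto_order.1 hlim).2 ((2 : ℝ≥0∞) ^ i)⁻¹ (by simp)).exists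
    refine ⟨restr Y n, ⟨by simp, ?_⟩, mem_cyl_restr_self Y n⟩
    exact (hsmall _ _).1 hn.le

end Computes

/-! ### The tally functional on finite strings -/

section Theta

variable {Θ : (ℕ → Bool) → ℕ → ℕ → Prop} {X : ℕ → Bool} {n : ℕ}

theorem theta_eq_top_iff : theta Θ X n = ⊤ ↔ ∀ s, ¬ Θ X n s := by
  simp [theta, iInf_eq_top]

theorem le_theta {N : ℕ} (h : ∀ t < N, ¬ Θ X n t) : (N : ℕ∞) ≤ theta Θ X n :=
  le_iInf₂ fun s hs => Nat.cast_le.2 (not_lt.1 fun hlt => h s hlt hs)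

theorem theta_eq_coe {s : ℕ} (hs : Θ X n s) (h : ∀ t < s, ¬ Θ X n t) : theta Θ X n = s :=
  le_antisymm (iInf₂_le s hs) (le_theta h)

theorem tally_eq_false_iff {m : ℕ} : tally Θ X m = false ↔
    ∃ k : ℕ, (∑ i ∈ Finset.range (k + 1), theta Θ X i) + k = (m : ℕ∞) := by
  simp [tally]

/-- The first infinite block of ones begins after finitely many zeros. -/
theorem finite_setOf_tally_eq_false (h : theta Θ X n = ⊤) : {m | tally Θ X m = false}.Finite := by
  refine ((Finset.range n).finite_toSet.image
    fun k => ((∑ i ∈ Finset.range (k + 1), theta Θ X i) + k).toNat).subset fun m hm => ?_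
  obtain ⟨k, hk⟩ := tally_eq_false_iff.1 hm
  refine ⟨k, Finset.mem_coe.2 (Finset.mem_range.2 (not_le.1 fun hnk => ?_)), by simp [hk]⟩
  have : ∑ i ∈ Finset.range (k + 1), theta Θ X i = ⊤ :=
    WithTop.sum_eq_top.2 ⟨n, Finset.mem_range.2 (by omega), h⟩
  simp [this] at hk

theorem infinite_setOf_tally_eq_false (h : ∀ n, theta Θ X n ≠ ⊤) :
    {m | tally Θ X m = false}.Infinite := by
  refine Set.infinite_of_not_bddAbove fun ⟨b, hb⟩ => ?_
  have hne : (∑ i ∈ Finset.range (b + 1 + 1), theta Θ X i) + (b + 1 : ℕ) ≠ ⊤ := by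
    refine WithTop.add_ne_top.2 ⟨WithTop.sum_ne_top.2 fun i _ => h i, ENat.natCast_ne_top _⟩
  obtain ⟨m, hm⟩ := ENat.ne_top_iff_exists.1 hne
  have h₁ : m ≤ b := hb (tally_eq_false_iff.2 ⟨b + 1, hm.symm⟩)
  have h₂ : ((b + 1 : ℕ) : ℕ∞) ≤ m := hm ▸ le_add_self
  have := Nat.cast_le.1 h₂
  omega

end Theta

/-- The `N` by `N` square of bits of the approximation: the first `N` bits of the first `N`
stages. -/
def stageTable (As : ℕ → ℕ → Bool) (N : ℕ) : List (List Bool) :=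
  (List.range N).map fun s => restr (As s) N

/-- The index of the first row of `T` that has the same first `i` bits as `τ`, and the length
of `T` if there is none. -/
def firstAgreement (T : List (List Bool)) (τ : List Bool) (i : ℕ) : ℕ :=
  T.findIdx fun r => decide (r.take i = τ.take i)

/-- The first `N` bits of the output of the tally functional of an approximation with table `T`,
on an input that begins with the string `τ` of length `N`. -/
def tallyTable (T : List (List Bool)) (τ : List Bool) : List Bool :=
  (List.range τ.length).map fun m => decide ¬ ∃ k < τ.length,
    ((List.range (k + 1)).map (firstAgreement T τ)).sum + k = m

/-- On an `N` by `N` table, `firstAgreement` is `θ` truncated at `N`. -/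
theorem firstAgreement_stageTable (As : ℕ → ℕ → Bool) (X : ℕ → Bool) {N i : ℕ} (hi : i ≤ N) :
    (firstAgreement (stageTable As N) (restr X N) i : ℕ∞) =
      min (theta (fun X n s => restr X n = restr (As s) n) X i) N := by
  set t := firstAgreement (stageTable As N) (restr X N) i with ht
  have hlen : (stageTable As N).length = N := by simp [stageTable]
  have hnot (s : ℕ) (hs : s < t) (hsN : s < N) : ¬ restr X i = restr (As s) i := by
    have := List.not_of_lt_findIdx (ht ▸ hs)
    intro heq
    simp [stageTable, take_restr _ hi, heq] at this
  have htN : t ≤ N := hlen ▸ List.findIdx_le_length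
  rcases htN.lt_or_eq with hlt | heq
  · have hagree : restr X i = restr (As t) i := by
      have := List.findIdx_getElem (xs := stageTable As N)
        (p := fun r => decide (r.take i = (restr X N).take i)) (w := by rw [hlen]; exact hlt)
      change decide ((stageTable As N)[t].take i = (restr X N).take i) = true at this
      simp only [stageTable, List.getElem_map, List.getElem_range, take_restr _ hi,
        decide_eq_true_iff] at this
      exact this.symm
    rw [theta_eq_coe (Θ := fun X n s => restr X n = restr (As s) n) hagree
      fun s hs => hnot s hs (hs.trans hlt), min_eq_left (Nat.cast_le.2 htN)]
  · rw [heq, min_eq_right (le_theta fun s hs => hnot s (heq ▸ hs) hs)]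

theorem sum_theta_eq_iff (As : ℕ → ℕ → Bool) (X : ℕ → Bool) {N k m : ℕ} (hk : k < N)
    (hm : m < N) :
    (∑ i ∈ Finset.range (k + 1), theta (fun X n s => restr X n = restr (As s) n) X i) + k =
        (m : ℕ∞) ↔
      ((List.range (k + 1)).map (firstAgreement (stageTable As N) (restr X N))).sum + k = m := by
  set T := stageTable As N
  set θ := theta (fun X n s => restr X n = restr (As s) n) X
  have hmin (i : ℕ) (hi : i ∈ Finset.range (k + 1)) :
      (firstAgreement T (restr X N) i : ℕ∞) = min (θ i) N :=
    firstAgreement_stageTable As X (by have := Finset.mem_range.1 hi; omega)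
  have hsum : ((List.range (k + 1)).map (firstAgreement T (restr X N))).sum =
      ∑ i ∈ Finset.range (k + 1), firstAgreement T (restr X N) i := rfl
  rw [hsum]
  -- Each summand of a sum below `N` is below `N`, where the two notions agree.
  constructor
  · intro h
    have heq (i : ℕ) (hi : i ∈ Finset.range (k + 1)) :
        (firstAgreement T (restr X N) i : ℕ∞) = θ i := by
      rw [hmin i hi, min_eq_left]
      calc θ i ≤ ∑ i ∈ Finset.range (k + 1), θ i := Finset.single_le_sum_of_canonicallyOrdered hi
        _ ≤ m := h ▸ le_self_add
        _ ≤ N := Nat.cast_le.2 hm.le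
    rw [← Finset.sum_congr rfl heq] at h
    exact_mod_cast h
  · intro h
    have heq (i : ℕ) (hi : i ∈ Finset.range (k + 1)) :
        θ i = (firstAgreement T (restr X N) i : ℕ∞) := by
      have hlt : firstAgreement T (restr X N) i < N := by
        have := Finset.single_le_sum_of_canonicallyOrdered
          (f := firstAgreement T (restr X N)) hi
        omega
      have hlt' : min (θ i) (N : ℕ∞) < N := hmin i hi ▸ Nat.cast_lt.2 hlt
      rw [hmin i hi, min_eq_left (le_of_lt (by simpa using hlt'))]
    rw [Finset.sum_congr rfl heq]
    exact_mod_cast h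

/-- The zero that closes block `k` stands at position `k` or later, and no block before it is
longer than this position. So the first `N` bits of the output depend only on blocks with index
and length below `N`, which the `N` by `N` table decides. -/
theorem restr_tallyApprox (As : ℕ → ℕ → Bool) (X : ℕ → Bool) (N : ℕ) :
    restr (tallyApprox As X) N = tallyTable (stageTable As N) (restr X N) := by
  rw [restr, tallyTable, length_restr]
  refine List.map_congr_left fun m hm => ?_
  have hm : m < N := List.mem_range.1 hm
  rw [tallyApprox, Bool.eq_iff_iff, ← Bool.not_eq_false, tally_eq_false_iff, decide_eq_true_iff,
    not_iff_not]
  constructor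
  · rintro ⟨k, hk⟩
    have hkm : (k : ℕ∞) ≤ m := hk ▸ le_add_self
    have hkN : k < N := (Nat.cast_le.1 hkm).trans_lt hm
    exact ⟨k, hkN, (sum_theta_eq_iff As X hkN hm).1 hk⟩
  · rintro ⟨k, hkN, hk⟩
    exact ⟨k, (sum_theta_eq_iff As X hkN hm).2 hk⟩

theorem primrec_firstAgreement :
    Primrec fun p : (List (List Bool) × List Bool) × ℕ => firstAgreement p.1.1 p.1.2 p.2 := by
  have h₁ : Primrec₂ fun (p : (List (List Bool) × List Bool) × ℕ) (r : List Bool) => r.take p.2 :=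
    Primrec.list_take.comp (Primrec.snd.comp Primrec.fst) Primrec.snd
  have h₂ : Primrec₂ fun (p : (List (List Bool) × List Bool) × ℕ) (_ : List Bool) =>
      p.1.2.take p.2 :=
    Primrec.list_take.comp (Primrec.snd.comp Primrec.fst)
      (Primrec.snd.comp (Primrec.fst.comp Primrec.fst))
  exact Primrec.list_findIdx (Primrec.fst.comp Primrec.fst) (Primrec.eq.decide.comp₂ h₁ h₂)

theorem primrec_tallyTable : Primrec₂ tallyTable := by
  have hsum : Primrec fun p : (List (List Bool) × List Bool) × ℕ =>
      ((List.range (p.2 + 1)).map (firstAgreement p.1.1 p.1.2)).sum + p.2 := by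
    refine Primrec.nat_add.comp (primrec_list_sum.comp (Primrec.list_map
      (Primrec.list_range.comp (Primrec.succ.comp Primrec.snd)) ?_)) Primrec.snd
    exact primrec_firstAgreement.comp ((Primrec.fst.comp Primrec.fst).pair Primrec.snd)
  have hR : PrimrecRel fun (k : ℕ) (q : (List (List Bool) × List Bool) × ℕ) =>
      ((List.range (k + 1)).map (firstAgreement q.1.1 q.1.2)).sum + k = q.2 :=
    Primrec.eq.comp
      (hsum.comp ((Primrec.fst.comp Primrec.snd).pair Primrec.fst)) (Primrec.snd.comp Primrec.snd)
  have hlen : Primrec fun q : (List (List Bool) × List Bool) × ℕ => q.1.2.length :=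
    Primrec.list_length.comp (Primrec.snd.comp Primrec.fst)
  have hbit : PrimrecPred fun q : (List (List Bool) × List Bool) × ℕ => ¬ ∃ k < q.1.2.length,
      ((List.range (k + 1)).map (firstAgreement q.1.1 q.1.2)).sum + k = q.2 :=
    (hR.exists_mem_list.comp (Primrec.list_range.comp hlen) Primrec.id).not.of_eq
      fun q => by simp
  exact Primrec.list_map (Primrec.list_range.comp (Primrec.list_length.comp Primrec.snd))
    hbit.decide.to₂

theorem computable_stageTable {As : ℕ → ℕ → Bool} (h : Computable₂ As) :
    Computable (stageTable As) := by
  have h₁ : Computable₂ fun s N => restr (As s) N := computable_map_range h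
  have h₂ : Computable₂ fun N s => restr (As s) N := h₁.comp Computable.snd Computable.fst
  exact (computable_map_range h₂).comp Computable.id Computable.id

theorem computes_tallyApprox {As : ℕ → ℕ → Bool} (h : Computable₂ As) :
    Computes (fun τ => tallyTable (stageTable As τ.length) τ) (tallyApprox As) where
  computable := primrec_tallyTable.to_comp.comp
    ((computable_stageTable h).comp Computable.list_length) Computable.id
  restr_apply X n := by rw [restr_tallyApprox, length_restr]

/-! ### Sequences that end in ones -/

theorem exists_eq_getD {Y : ℕ → Bool} (h : {m | Y m = false}.Finite) :
    ∃ l : List Bool, Y = fun m => l.getD m true := by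
  obtain ⟨b, hb⟩ := h.bddAbove
  refine ⟨restr Y (b + 1), funext fun m => ?_⟩
  by_cases hm : m < b + 1
  · rw [List.getD_eq_getElem?_getD, getElem?_restr hm, Option.getD_some]
  · rw [List.getD_eq_default _ _ (by simpa using hm)]
    by_contra hY
    exact hm (Nat.lt_succ_of_le (hb (by simpa using hY)))

theorem countable_setOf_finite_false : {Y : ℕ → Bool | {m | Y m = false}.Finite}.Countable :=
  (Set.countable_range fun (l : List Bool) m => l.getD m true).mono fun _ hY =>
    (exists_eq_getD hY).imp fun _ => Eq.symm

theorem computable_of_finite_false {Y : ℕ → Bool} (h : {m | Y m = false}.Finite) :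
    Computable Y := by
  obtain ⟨l, rfl⟩ := exists_eq_getD h
  exact ((Primrec.list_getD true).comp (Primrec.const l) Primrec.id).to_comp

/-! ### Inputs with an infinite output -/

/-- If every prefix of `X` is a prefix of some stage, then either infinitely many stages are used,
which forces `X = A`, or `X` is one of the finitely many stages that are used. -/
theorem eq_or_eq_stage_of_theta_ne_top {As : ℕ → ℕ → Bool} {A X : ℕ → Bool}
    (hAs : ∀ n, ∀ᶠ s in atTop, As s n = A n)
    (h : ∀ n, theta (fun X n s => restr X n = restr (As s) n) X n ≠ ⊤) :
    X = A ∨ ∃ s, X = As s := by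
  by_contra! hX
  obtain ⟨m, hm⟩ := Function.ne_iff.1 hX.1
  obtain ⟨s₀, hs₀⟩ := eventually_atTop.1 (hAs m)
  choose d hd using fun s => Function.ne_iff.1 (hX.2 s)
  -- A length at which `X` differs from all stages before `s₀`, and from all later ones at `m`.
  have hfin := mt theta_eq_top_iff.2 (h (max m ((Finset.range s₀).sup d) + 1))
  push Not at hfin
  obtain ⟨s, hs⟩ := hfin
  rw [restr_eq_restr_iff] at hs
  rcases lt_or_ge s s₀ with hlt | hge
  · have hds : d s ≤ (Finset.range s₀).sup d := Finset.le_sup (Finset.mem_range.2 hlt)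
    exact hd s (hs _ (by omega))
  · exact hm ((hs m (by omega)).trans (hs₀ s hge))

theorem theta_ne_top {As : ℕ → ℕ → Bool} {A : ℕ → Bool}
    (hAs : ∀ n, ∀ᶠ s in atTop, As s n = A n) (n : ℕ) :
    theta (fun X n s => restr X n = restr (As s) n) A n ≠ ⊤ := by
  have : ∀ᶠ s in atTop, ∀ i ∈ Finset.range n, As s i = A i :=
    (eventually_all_finset _).2 fun i _ => hAs i
  obtain ⟨s, hs⟩ := this.exists
  refine fun htop => theta_eq_top_iff.1 htop s (restr_eq_restr_iff.2 fun i hi => ?_)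
  exact (hs i (Finset.mem_range.2 hi)).symm

/-- Only `A` and the stages of its approximation are sent to sequences with infinitely many
zeros. -/
theorem countable_setOf_infinite_tally {As : ℕ → ℕ → Bool} {A : ℕ → Bool}
    (hAs : ∀ n, ∀ᶠ s in atTop, As s n = A n) :
    {X | {m | tallyApprox As X m = false}.Infinite}.Countable := by
  refine ((Set.countable_singleton A).union (Set.countable_range As)).mono fun X hX => ?_
  rcases eq_or_eq_stage_of_theta_ne_top hAs
    (X := X) fun n hn => hX (finite_setOf_tally_eq_false hn) with rfl | ⟨s, rfl⟩
  · exact Or.inl rfl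
  · exact Or.inr ⟨s, rfl⟩

/-- An output on an input other than `A` either ends in ones or comes from a stage of the
approximation, which is computable. -/
theorem computable_tallyApprox_of_ne {As : ℕ → ℕ → Bool} {A : ℕ → Bool}
    (hAs : IsDelta2Approx As A) {X : ℕ → Bool} (hX : X ≠ A) : Computable (tallyApprox As X) := by
  by_cases h : {m | tallyApprox As X m = false}.Finite
  · exact computable_of_finite_false h
  · obtain ⟨s, rfl⟩ := (eq_or_eq_stage_of_theta_ne_top hAs.tendsto
      fun n hn => h (finite_setOf_tally_eq_false hn)).resolve_left hX
    exact (computes_tallyApprox hAs.computable).computable_apply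
      (hAs.computable.comp (Computable.const s) Computable.id)

/-- A measure that is carried by a countable set `E` is trivial: the members of `E` that are not
atoms form a countable union of null singletons. -/
theorem isTrivial_of_countable {μ : Measure (ℕ → Bool)} (hμ : IsComputableProb μ)
    {E : Set (ℕ → Bool)} (hE : E.Countable) (hae : ∀ᵐ Y ∂μ, Y ∈ E) : IsTrivial μ := by
  have := hμ.1
  refine ⟨hμ, le_antisymm prob_le_one ?_⟩
  have hnull : μ (E \ atoms μ) = 0 := by
    rw [← Set.biUnion_of_singleton (E \ atoms μ),
      measure_biUnion_null_iff (hE.mono Set.sdiff_subset)]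
    intro Y hY
    simpa [atoms] using hY.2
  have hatoms : ∀ᵐ Y ∂μ, Y ∈ atoms μ := by
    filter_upwards [hae, measure_eq_zero_iff_ae_notMem.1 hnull] with Y hY hY'
    by_contra hn
    exact hY' ⟨hY, hn⟩
  rw [measure_eq_measure_of_null_sdiff (Set.subset_univ _)
    (by simpa [Set.compl_eq_univ_sdiff] using mem_ae_iff.1 hatoms), measure_univ]

end Cantor

theorem mainTheorem7 (A : ℕ → Bool) (As : ℕ → ℕ → Bool)
    (hA : ¬ Computable A) (hAs : Cantor.IsDelta2Approx As A) :
    Cantor.IsTrivial (Cantor.inducedMeasure (Cantor.tallyApprox As)) ∧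
    (A ∈ Cantor.MLR Cantor.lebesgue →
      Cantor.MLR (Cantor.inducedMeasure (Cantor.tallyApprox As)) \
          Cantor.atoms (Cantor.inducedMeasure (Cantor.tallyApprox As)) =
        {Cantor.tallyApprox As A}) := by
  have h := Cantor.computes_tallyApprox hAs.computable
  have hinf := Cantor.countable_setOf_infinite_tally hAs.tendsto
  refine ⟨Cantor.isTrivial_of_countable h.isComputableProb Cantor.countable_setOf_finite_false ?_,
    fun hrand => Set.Subset.antisymm ?_ ?_⟩
  · refine (ae_map_iff h.continuous.measurable.aemeasurable
      Cantor.countable_setOf_finite_false.measurableSet).2 ?_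
    filter_upwards [measure_eq_zero_iff_ae_notMem.1 (hinf.measure_zero Cantor.lebesgue)] with X hX
    exact Set.not_infinite.1 hX
  · rintro Y ⟨hY, hatom⟩
    obtain ⟨X, rfl⟩ := h.mem_range_of_mem_MLR hY
    by_contra hne
    have hXA : X ≠ A := fun hXA => hne (hXA ▸ rfl)
    exact hatom (h.mem_atoms_of_computable (Cantor.computable_tallyApprox_of_ne hAs hXA) hY)
  · rintro _ rfl
    refine ⟨h.apply_mem_MLR hrand, ?_⟩
    have hnull : Cantor.inducedMeasure (Cantor.tallyApprox As) {Cantor.tallyApprox As A} = 0 := by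
      -- The output on `A` has infinitely many zeros, so its preimage is countable.
      rw [h.inducedMeasure_apply (measurableSet_singleton _)]
      refine (hinf.mono fun X hX => ?_).measure_zero Cantor.lebesgue
      rw [Set.mem_ofPred_eq, show Cantor.tallyApprox As X = Cantor.tallyApprox As A from hX]
      exact Cantor.infinite_setOf_tally_eq_false (Cantor.theta_ne_top hAs.tendsto)
    simp [Cantor.atoms, hnull]
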